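/- Fix a first-order language and a countably infinite set of variables. A query is a finite sequence of atoms; an atomic query is a single atom. A definite program $P$ is a finite set of clauses $A'\leftarrow B_1,\ldots,B_n$ ($n\ge 0$), where $A',B_1,\ldots,B_n$ are atoms. Write $\mathrm{rel}(A)$ for the predicate of an atom $A$. Derivations are SLD-derivations in which the leftmost atom of the query is always selected (LD-derivations), the input clauses being variants of clauses of $P$ that are variable-disjoint from the initial query and from the substitutions and input clauses used earlier. A computed answer substitution for $\leftarrow Q$ is the composition of the most general unifiers of a derivation from $Q$ to the empty query, restricted to the variables of $Q$. The LD-tree of $(P,Q)$ is the tree of LD-derivations starting from $Q$ in which every node has exactly one child for each clause of $P$ that can be resolved with its leftmost atom (it is determined up to the choice of unifiers and renamings). $P$ is LD-terminating for $Q$ if the LD-tree of $(P,Q)$ is finite. A predicate $p$ refers to $q$ in $P$ if some clause of $P$ has $p$ in its head and $q$ in its body; $p\simeq q$ means that $(p,q)$ and $(q,p)$ both belong to the reflexive transitive closure of this relation. For a set $S$ of atomic queries, $\mathrm{Call}(P,S)$ is the set of all atoms $A$ such that a variant of $A$ is a selected atom in some LD-derivation of $P\cup\{\leftarrow Q\}$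 for some $Q\in S$. A quasi-ordering $\ge$ is a reflexive and transitive relation; $s>t$ means $s\ge t$ and not $t\ge s$; $\ge$ is well-founded if there is no infinite sequence $s_1>s_2>\cdots$. The program $P$ is order-acceptable with respect to $S$ if there is a well-founded quasi-ordering $\ge$ on the set of atoms modulo renaming of variables such that, for every $A\in\mathrm{Call}(P,S)$, every clause $A'\leftarrow B_1,\ldots,B_n$ of $P$ (renamed to be variable-disjoint from $A$) such that $A$ and $A'$ have a most general unifier $\theta$, every $i$ with $\mathrm{rel}(B_i)\simeq\mathrm{rel}(A)$, and every computed answer substitution $\sigma$ for $\leftarrow(B_1,\ldots,B_{i-1})\theta$, $$A > B_i\theta\sigma .$$ Theorem. Let $P$ be a definite program and let $S$ be a set of atomic queries. Then $P$ is order-acceptable with respect to $S$ if and only if $P$ is LD-terminating for every query in $S$. -/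

import Mathlib

universe u v

namespace LP

/-- Substitution of terms composes. -/
theorem term_subst_subst {L : FirstOrder.Language.{u, v}} (t : L.Term ℕ) (f g : ℕ → L.Term ℕ) :
    (t.subst f).subst g = t.subst (fun x => (f x).subst g) := by
  induction t with
  | var x => rfl
  | func F ts ih => simp only [FirstOrder.Language.Term.subst, ih]

theorem term_subst_var {L : FirstOrder.Language.{u, v}} (t : L.Term ℕ) :
    t.subst (fun x => FirstOrder.Language.Term.var x) = t := by
  induction t with
  | var x => rfl
  | func F ts ih => simp only [FirstOrder.Language.Term.subst, ih]

/-! ### Atoms, queries, clauses, programs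

Terms are the terms of a first-order language `L` over the countably infinite set `ℕ` of
variables. -/

/-- Predicate symbols of `L`, with their arities. -/
abbrev Pred (L : FirstOrder.Language.{u, v}) := Σ n, L.Relations n

/-- An atom `p(t₁, …, tₙ)`; `A.pred` is `rel(A)`. -/
structure Atom (L : FirstOrder.Language.{u, v}) where
  pred : Pred L
  args : Fin pred.1 → L.Term ℕ

/-- A query is a finite sequence of atoms. -/
abbrev Query (L : FirstOrder.Language.{u, v}) := List (Atom L)

/-- A definite clause `head ← body`. -/
structure Clause (L : FirstOrder.Language.{u, v}) where
  head : Atom L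
  body : List (Atom L)

/-- A definite program is a finite set of definite clauses. -/
abbrev Program (L : FirstOrder.Language.{u, v}) := Finset (Clause L)

variable {L : FirstOrder.Language.{u, v}}

def Atom.vars (A : Atom L) : Set ℕ := {x | ∃ i, x ∈ (A.args i).varFinset}

def queryVars (Q : Query L) : Set ℕ := {x | ∃ A ∈ Q, x ∈ A.vars}

def Clause.vars (c : Clause L) : Set ℕ := c.head.vars ∪ queryVars c.body

/-- Replace every variable `x` of an atom by the term `f x`. -/
def Atom.subst (A : Atom L) (f : ℕ → L.Term ℕ) : Atom L :=
  ⟨A.pred, fun i => (A.args i).subst f⟩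

/-- A substitution: a map from variables to terms that moves only finitely many variables. -/
structure Subst (L : FirstOrder.Language.{u, v}) where
  toFun : ℕ → L.Term ℕ
  finite_support : {x | toFun x ≠ FirstOrder.Language.Term.var x}.Finite

instance : CoeFun (Subst L) (fun _ => ℕ → L.Term ℕ) := ⟨Subst.toFun⟩

/-- The variables of a substitution: those in its domain and those in the images of its domain. -/
def Subst.vars (θ : Subst L) : Set ℕ :=
  {x | θ x ≠ FirstOrder.Language.Term.var x} ∪
    {y | ∃ x, θ x ≠ FirstOrder.Language.Term.var x ∧ y ∈ (θ x).varFinset}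

/-- Apply a substitution to a query. -/
def substQuery (Q : Query L) (θ : Subst L) : Query L := Q.map (fun A => A.subst θ)

/-- `θ` is a most general unifier of `A` and `B`. -/
def IsMGU (θ : Subst L) (A B : Atom L) : Prop :=
  A.subst θ = B.subst θ ∧
    ∀ η : Subst L, A.subst η = B.subst η → ∃ γ : Subst L, ∀ x, η x = (θ x).subst γ

/-! ### Variants and the extended Herbrand base -/

/-- Rename the variables of an atom by a permutation. -/
def Atom.rename (A : Atom L) (ρ : Equiv.Perm ℕ) : Atom L :=
  A.subst (fun x => FirstOrder.Language.Term.var (ρ x))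

def Atom.IsVariant (A B : Atom L) : Prop := ∃ ρ : Equiv.Perm ℕ, A.rename ρ = B

def Clause.IsVariant (c d : Clause L) : Prop :=
  ∃ ρ : Equiv.Perm ℕ, c.head.rename ρ = d.head ∧ c.body.map (fun A => A.rename ρ) = d.body

theorem Atom.rename_rename (A : Atom L) (ρ τ : Equiv.Perm ℕ) :
    (A.rename ρ).rename τ = A.rename (ρ.trans τ) := by
  simp only [Atom.rename, Atom.subst, term_subst_subst]
  rfl

theorem Atom.rename_refl (A : Atom L) : A.rename (Equiv.refl ℕ) = A := by
  simp only [Atom.rename, Atom.subst, Equiv.refl_apply, term_subst_var]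

instance variantSetoid (L : FirstOrder.Language.{u, v}) : Setoid (Atom L) where
  r := Atom.IsVariant
  iseqv :=
    { refl := fun A => ⟨Equiv.refl ℕ, A.rename_refl⟩
      symm := by
        rintro A B ⟨ρ, rfl⟩
        exact ⟨ρ.symm, by rw [Atom.rename_rename, Equiv.self_trans_symm, Atom.rename_refl]⟩
      trans := by
        rintro A B C ⟨ρ, rfl⟩ ⟨τ, rfl⟩
        exact ⟨ρ.trans τ, (Atom.rename_rename A ρ τ).symm⟩ }

/-- The extended Herbrand base: atoms modulo the variant relation. -/
abbrev ExtHerbrandBase (L : FirstOrder.Language.{u, v}) := Quotient (variantSetoid L)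

/-- The class of an atom in the extended Herbrand base. -/
def Atom.cls (A : Atom L) : ExtHerbrandBase L := Quotient.mk (variantSetoid L) A

/-! ### LD-derivations -/

/-- One resolution step: the program clause used, the variant of it that serves as
input clause, and the most general unifier. -/
structure Step (L : FirstOrder.Language.{u, v}) where
  clause : Clause L
  input : Clause L
  mgu : Subst L

/-- `LDDeriv P Q ss R`: the steps `ss`, listed with the latest step first, form a finite
LD-derivation of `P ∪ {← Q}` that ends in the query `R`. In every step the leftmost atom is
selected, and the input clause is a variant of a program clause that has no variable in common
with the initial query or with the substitutions and input clauses of the earlier steps. -/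
inductive LDDeriv (P : Program L) (Q : Query L) : List (Step L) → Query L → Prop
  | nil : LDDeriv P Q [] Q
  | step {ss : List (Step L)} {A : Atom L} {R : Query L} (s : Step L)
      (prev : LDDeriv P Q ss (A :: R))
      (mem : s.clause ∈ P)
      (variant : s.clause.IsVariant s.input)
      (apart_query : Disjoint s.input.vars (queryVars Q))
      (apart_steps : ∀ s' ∈ ss,
        Disjoint s.input.vars s'.input.vars ∧ Disjoint s.input.vars s'.mgu.vars)
      (mgu : IsMGU s.mgu A s.input.head) :
      LDDeriv P Q (s :: ss) (substQuery (s.input.body ++ R) s.mgu)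

/-- `t θ₁ θ₂ ⋯ θₘ` for the unifiers `θ₁, …, θₘ` of a derivation (latest step first). -/
def applySteps (ss : List (Step L)) (t : L.Term ℕ) : L.Term ℕ :=
  ss.foldr (fun s t => t.subst s.mgu) t

/-- `σ` is a computed answer substitution for `← Q`: the composition of the unifiers of an
LD-refutation of `P ∪ {← Q}`, restricted to the variables of `Q`. -/
def IsComputedAnswer (P : Program L) (Q : Query L) (σ : Subst L) : Prop :=
  ∃ ss, LDDeriv P Q ss [] ∧
    (∀ x ∈ queryVars Q, σ x = applySteps ss (FirstOrder.Language.Term.var x)) ∧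
    ∀ x, x ∉ queryVars Q → σ x = FirstOrder.Language.Term.var x

/-- The call set: all atoms having a variant that is the selected atom in some LD-derivation
for an atomic query in `S`. -/
def Call (P : Program L) (S : Set (Atom L)) : Set (Atom L) :=
  {A | ∃ Q ∈ S, ∃ ss A' R, LDDeriv P [Q] ss (A' :: R) ∧ A.IsVariant A'}

/-! ### LD-trees and LD-termination -/

/-- An LD-tree for `(P, Q)`. A node is identified with the LD-derivation leading to it from the
root; each node has exactly one child for each program clause by which its derivation can be
extended (and no others). -/
structure LDTree (P : Program L) (Q : Query L) where
  nodes : Set (List (Step L))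
  root_mem : [] ∈ nodes
  parent_mem : ∀ s ss, s :: ss ∈ nodes → ss ∈ nodes
  isDeriv : ∀ ss ∈ nodes, ∃ R, LDDeriv P Q ss R
  children : ∀ ss ∈ nodes, ∀ c ∈ P,
    (∃ s : Step L, s.clause = c ∧ ∃ R, LDDeriv P Q (s :: ss) R) →
      ∃! s : Step L, s.clause = c ∧ s :: ss ∈ nodes

/-- `Q` LD-terminates for `P`: the LD-tree for `(P, Q)` is finite. The tree is determined up to
the choice of unifiers and of variants of clauses; finiteness is asked for every choice. -/
def LDTerminates (P : Program L) (Q : Query L) : Prop :=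
  ∀ T : LDTree P Q, T.nodes.Finite

/-- A choice of a step by which the derivation `ss` is extended with the clause `c`. -/
def IsChosen (P : Program L) (Q : Query L)
    (next : List (Step L) → Clause L → Step L) : List (Step L) → Prop
  | [] => True
  | s :: ss => IsChosen P Q next ss ∧ s = next ss s.clause ∧ ∃ R, LDDeriv P Q (s :: ss) R

/-- There is always an LD-tree. -/
theorem nonempty_LDTree (P : Program L) (Q : Query L) : Nonempty (LDTree P Q) := by
  classical
  have h : ∀ (ss : List (Step L)) (c : Clause L), ∃ s : Step L,
      (∃ s' : Step L, s'.clause = c ∧ ∃ R, LDDeriv P Q (s' :: ss) R) →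
        s.clause = c ∧ ∃ R, LDDeriv P Q (s :: ss) R := by
    intro ss c
    by_cases hs : ∃ s' : Step L, s'.clause = c ∧ ∃ R, LDDeriv P Q (s' :: ss) R
    · obtain ⟨s, hs'⟩ := hs
      exact ⟨s, fun _ => hs'⟩
    · exact ⟨⟨c, c, ⟨FirstOrder.Language.Term.var, by simp⟩⟩, fun h => absurd h hs⟩
  choose next hnext using h
  refine ⟨⟨{ss | IsChosen P Q next ss}, trivial, fun s ss hs => hs.1, ?_, ?_⟩⟩
  · intro ss hss
    cases ss with
    | nil => exact ⟨Q, LDDeriv.nil⟩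
    | cons s ss => exact hss.2.2
  · intro ss hss c _ hc
    obtain ⟨h1, h2⟩ := hnext ss c hc
    refine ⟨next ss c, ⟨h1, hss, by rw [h1], h2⟩, ?_⟩
    rintro s ⟨rfl, hs⟩
    exact hs.2.1

/-! ### Mutual recursion -/

/-- `p` refers to `q` in `P`. -/
def Refers (P : Program L) (p q : Pred L) : Prop :=
  ∃ c ∈ P, c.head.pred = p ∧ ∃ B ∈ c.body, B.pred = q

/-- `p` depends on `q` in `P`. -/
def Depends (P : Program L) : Pred L → Pred L → Prop :=
  Relation.ReflTransGen (Refers P)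

/-- `p` and `q` are mutually recursive in `P`. -/
def MutuallyRecursive (P : Program L) (p q : Pred L) : Prop :=
  Depends P p q ∧ Depends P q p

/-! ### Order-acceptability -/

/-- The ordering `>` associated with a quasi-ordering `≥`. -/
def Strict {α : Type*} (ge : α → α → Prop) (a b : α) : Prop := ge a b ∧ ¬ ge b a

/-- `ge` is a quasi-ordering without infinite descending sequences `s₀ > s₁ > ⋯`. -/
structure IsWellFoundedQuasiOrdering {α : Type*} (ge : α → α → Prop) : Prop where
  refl : ∀ a, ge a a
  trans : ∀ a b c, ge a b → ge b c → ge a c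
  wf : ¬ ∃ s : ℕ → α, ∀ n, Strict ge (s n) (s (n + 1))

/-- `P` is order-acceptable with respect to `S`. As usual in resolution, the head of a clause is
unified with `A` after the clause has been renamed apart from `A`. -/
def OrderAcceptable (P : Program L) (S : Set (Atom L)) : Prop :=
  ∃ ge : ExtHerbrandBase L → ExtHerbrandBase L → Prop, IsWellFoundedQuasiOrdering ge ∧
    ∀ A ∈ Call P S,
    ∀ c ∈ P, ∀ c' : Clause L, c.IsVariant c' → Disjoint c'.vars A.vars →
    ∀ θ : Subst L, IsMGU θ A c'.head →
    ∀ (pre : List (Atom L)) (B : Atom L) (post : List (Atom L)), c'.body = pre ++ B :: post →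
    MutuallyRecursive P B.pred A.pred →
    ∀ σ : Subst L, IsComputedAnswer P (substQuery pre θ) σ →
      Strict ge A.cls ((B.subst θ).subst σ).cls

end LP

namespace LP

open FirstOrder.Language

variable {L : FirstOrder.Language.{u, v}}

/-! ### Terms, atoms and queries under substitution -/

/-! Finiteness of LD-trees is replaced by `Terminates`: accessibility of a query under resolution
steps in which the input clause need only be apart from the current query and any most general
unifier is allowed. The lifting property carries everything: if a query is an instance of a prefix
of another, each of its steps is matched by a step of the more general query (`Resolves.simulate`).
So termination passes to instances of prefixes, choices of unifiers and renamings do not matter, and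
`Terminates` agrees with `LDTerminates` because a program has finitely many clauses.

If all queries in `S` terminate, order atoms by `Above`: a terminating atom is above every instance
of an atom selected later in its resolution. By lifting this is transitive, and an infinite descent
would give an infinite resolution (`Terminates.acc_above`). An instance of a body atom under a
computed answer is such an atom by `IsComputedAnswer.exists_reaches`.

Conversely, given an ordering, `terminates_of_orderAcceptable` shows that every call terminates, by
induction first on the dependency of predicates and then on the ordering. The body atoms are treated
from left to right: `Terminates.append` reduces a query to its first atom and what remains after
that atom is solved, and `exists_isComputedAnswer` turns such a partial resolution into a computed
answer to which the ordering condition applies. -/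

theorem term_subst_congr_iff {t : L.Term ℕ} {f g : ℕ → L.Term ℕ} :
    t.subst f = t.subst g ↔ ∀ x ∈ t.varFinset, f x = g x := by
  induction t with
  | var x => simp [Term.subst, Term.varFinset]
  | func F ts ih =>
    simp only [Term.subst, Term.func.injEq, heq_eq_eq, true_and, funext_iff, ih, Term.varFinset,
      Finset.mem_biUnion, Finset.mem_univ]
    exact ⟨fun h x ⟨i, hx⟩ => h i x hx, fun h i x hx => h x ⟨i, hx⟩⟩

theorem mem_varFinset_subst {t : L.Term ℕ} {f : ℕ → L.Term ℕ} {y : ℕ} :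
    y ∈ (t.subst f).varFinset ↔ ∃ x ∈ t.varFinset, y ∈ (f x).varFinset := by
  induction t with
  | var x => simp [Term.subst, Term.varFinset]
  | func F ts ih =>
    simp only [Term.subst, Term.varFinset, Finset.mem_biUnion, Finset.mem_univ, true_and, ih]
    exact ⟨fun ⟨i, x, hx, hy⟩ => ⟨x, ⟨i, hx⟩, hy⟩, fun ⟨x, ⟨i, hx⟩, hy⟩ => ⟨i, x, hx, hy⟩⟩

/-- Composition of substitutions, `f` first. -/
def comp (f g : ℕ → L.Term ℕ) : ℕ → L.Term ℕ := fun x => (f x).subst g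

theorem Atom.subst_subst (A : Atom L) (f g : ℕ → L.Term ℕ) :
    (A.subst f).subst g = A.subst (comp f g) := by
  simp only [Atom.subst, term_subst_subst]
  rfl

theorem Atom.subst_var (A : Atom L) : A.subst Term.var = A := by
  simp only [Atom.subst]
  congr
  funext i
  exact term_subst_var _

theorem Atom.subst_congr_iff {A : Atom L} {f g : ℕ → L.Term ℕ} :
    A.subst f = A.subst g ↔ ∀ x ∈ A.vars, f x = g x := by
  simp only [Atom.subst, Atom.mk.injEq, heq_eq_eq, true_and, funext_iff, term_subst_congr_iff,
    Atom.vars, Set.mem_ofPred_eq]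
  exact ⟨fun h x ⟨i, hx⟩ => h i x hx, fun h i x hx => h x ⟨i, hx⟩⟩

theorem Atom.mem_vars_subst {A : Atom L} {f : ℕ → L.Term ℕ} {y : ℕ} :
    y ∈ (A.subst f).vars ↔ ∃ x ∈ A.vars, y ∈ (f x).varFinset := by
  simp only [Atom.vars, Atom.subst, Set.mem_ofPred_eq, mem_varFinset_subst]
  exact ⟨fun ⟨i, x, hx, hy⟩ => ⟨x, ⟨i, hx⟩, hy⟩, fun ⟨x, ⟨i, hx⟩, hy⟩ => ⟨i, x, hx, hy⟩⟩

theorem Atom.finite_vars (A : Atom L) : A.vars.Finite := by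
  have : A.vars = ⋃ i, ((A.args i).varFinset : Set ℕ) := by ext; simp [Atom.vars]
  rw [this]
  exact Set.finite_iUnion fun i => Finset.finite_toSet _

/-- The instance of a query under a map from variables to terms. -/
def inst (Q : Query L) (f : ℕ → L.Term ℕ) : Query L := Q.map fun A => A.subst f

theorem substQuery_eq_inst (Q : Query L) (θ : Subst L) : substQuery Q θ = inst Q θ := rfl

@[simp] theorem inst_nil (f : ℕ → L.Term ℕ) : inst [] f = [] := rfl

@[simp] theorem inst_cons (A : Atom L) (Q : Query L) (f : ℕ → L.Term ℕ) :
    inst (A :: Q) f = A.subst f :: inst Q f := rfl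

@[simp] theorem inst_append (Q R : Query L) (f : ℕ → L.Term ℕ) :
    inst (Q ++ R) f = inst Q f ++ inst R f := List.map_append

@[simp] theorem length_inst (Q : Query L) (f : ℕ → L.Term ℕ) : (inst Q f).length = Q.length :=
  List.length_map _

theorem inst_inst (Q : Query L) (f g : ℕ → L.Term ℕ) : inst (inst Q f) g = inst Q (comp f g) := by
  simp only [inst, List.map_map, Function.comp_def, Atom.subst_subst]

theorem inst_var (Q : Query L) : inst Q Term.var = Q := by
  simp only [inst, Atom.subst_var, List.map_id']

theorem inst_congr_iff {Q : Query L} {f g : ℕ → L.Term ℕ} :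
    inst Q f = inst Q g ↔ ∀ x ∈ queryVars Q, f x = g x := by
  simp only [inst, List.map_inj_left, Atom.subst_congr_iff, queryVars, Set.mem_ofPred_eq]
  exact ⟨fun h x ⟨A, hA, hx⟩ => h A hA x hx, fun h A hA x hx => h x ⟨A, hA, hx⟩⟩

theorem mem_queryVars_inst {Q : Query L} {f : ℕ → L.Term ℕ} {y : ℕ} :
    y ∈ queryVars (inst Q f) ↔ ∃ x ∈ queryVars Q, y ∈ (f x).varFinset := by
  simp only [queryVars, inst, List.mem_map, Set.mem_ofPred_eq]
  constructor
  · rintro ⟨_, ⟨A, hA, rfl⟩, hy⟩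
    obtain ⟨x, hx, hy⟩ := Atom.mem_vars_subst.1 hy
    exact ⟨x, ⟨A, hA, hx⟩, hy⟩
  · rintro ⟨x, ⟨A, hA, hx⟩, hy⟩
    exact ⟨_, ⟨A, hA, rfl⟩, Atom.mem_vars_subst.2 ⟨x, hx, hy⟩⟩

theorem finite_queryVars (Q : Query L) : (queryVars Q).Finite := by
  have : queryVars Q = ⋃ A ∈ {A | A ∈ Q}, A.vars := by ext; simp [queryVars]
  rw [this]
  exact (List.finite_toSet Q).biUnion fun A _ => A.finite_vars

@[simp] theorem queryVars_nil : queryVars ([] : Query L) = ∅ := by simp [queryVars]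

@[simp] theorem queryVars_cons (A : Atom L) (Q : Query L) :
    queryVars (A :: Q) = A.vars ∪ queryVars Q := by
  ext; simp [queryVars]

@[simp] theorem queryVars_append (Q R : Query L) :
    queryVars (Q ++ R) = queryVars Q ∪ queryVars R := by
  ext; simp [queryVars, or_and_right, exists_or]

theorem Clause.finite_vars (c : Clause L) : c.vars.Finite :=
  c.head.finite_vars.union (finite_queryVars _)

theorem Subst.finite_vars (θ : Subst L) : θ.vars.Finite := by
  refine θ.finite_support.union ?_
  have : {y | ∃ x, θ x ≠ Term.var x ∧ y ∈ (θ x).varFinset} =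
      ⋃ x ∈ {x | θ x ≠ Term.var x}, ((θ x).varFinset : Set ℕ) := by ext; simp
  rw [this]
  exact θ.finite_support.biUnion fun x _ => Finset.finite_toSet _

theorem Subst.apply_of_notMem_vars {θ : Subst L} {x : ℕ} (h : x ∉ θ.vars) : θ x = Term.var x := by
  by_contra hx
  exact h (Or.inl hx)

theorem Subst.mem_of_mem_apply {θ : Subst L} {x y : ℕ} (h : y ∈ (θ x).varFinset) :
    y = x ∨ y ∈ θ.vars := by
  by_cases hx : θ x = Term.var x
  · left
    simpa [hx, Term.varFinset] using h
  · exact Or.inr (Or.inr ⟨x, hx, h⟩)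

theorem queryVars_inst_subset (Q : Query L) (θ : Subst L) :
    queryVars (inst Q θ) ⊆ queryVars Q ∪ θ.vars := by
  intro y hy
  obtain ⟨x, hx, hy⟩ := mem_queryVars_inst.1 hy
  rcases Subst.mem_of_mem_apply hy with rfl | h
  · exact Or.inl hx
  · exact Or.inr h

/-- Any map agrees on a finite set with a substitution. -/
theorem exists_subst_eqOn {s : Set ℕ} (hs : s.Finite) (f : ℕ → L.Term ℕ) :
    ∃ θ : Subst L, ∀ x ∈ s, θ x = f x := by
  classical
  refine ⟨⟨fun x => if x ∈ s then f x else Term.var x, hs.subset fun x hx => ?_⟩, fun x hx => ?_⟩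
  · by_contra h
    simp [h] at hx
  · simp [hx]

/-! ### Renamings -/

/-- A finite set containing both `s` and its image has equally many elements outside either, so the
injection completes to a permutation of that finite set, and then by the identity. -/
theorem exists_perm_eqOn {s : Set ℕ} (hs : s.Finite) {f : ℕ → ℕ} (hf : Set.InjOn f s) :
    ∃ ρ : Equiv.Perm ℕ, ∀ x ∈ s, ρ x = f x := by
  classical
  let t : Finset ℕ := hs.toFinset ∪ hs.toFinset.image f
  have hst : ∀ x ∈ s, x ∈ t := fun x hx => by simp [t, hx]
  have hft : ∀ x ∈ s, f x ∈ t := fun x hx => by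
    simp only [t, Finset.mem_union, Finset.mem_image, Set.Finite.mem_toFinset]
    exact Or.inr ⟨x, hx, rfl⟩
  let g : {x : t // (x : ℕ) ∈ s} → t := fun x => ⟨f x.1, hft _ x.2⟩
  have hg : Function.Injective g := by
    intro x y hxy
    simp only [g, Subtype.mk.injEq] at hxy
    exact Subtype.ext (Subtype.ext (hf x.2 y.2 hxy))
  let e : {x : t // (x : ℕ) ∈ s} ≃ {x : t // x ∈ Set.range g} := Equiv.ofInjective g hg
  refine ⟨(e.extendSubtype).ofSubtype, fun x hx => ?_⟩
  rw [Equiv.Perm.ofSubtype_apply_of_mem _ (hst x hx)]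
  exact congrArg Subtype.val (e.extendSubtype_apply_of_mem ⟨x, hst x hx⟩ hx)

theorem Clause.IsVariant.exists_inst {c d : Clause L} (h : c.IsVariant d) :
    ∃ ρ : Equiv.Perm ℕ, d.head = c.head.subst (fun x => Term.var (ρ x)) ∧
      d.body = inst c.body (fun x => Term.var (ρ x)) := by
  obtain ⟨ρ, h1, h2⟩ := h
  exact ⟨ρ, h1.symm, h2.symm⟩

theorem Clause.IsVariant.exists_map {c d e : Clause L} (hd : c.IsVariant d) (he : c.IsVariant e) :
    ∃ f : ℕ → L.Term ℕ, e.head = d.head.subst f ∧ e.body = inst d.body f := by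
  obtain ⟨ρ, h1, h2⟩ := hd.exists_inst
  obtain ⟨τ, h3, h4⟩ := he.exists_inst
  have : comp (fun x => Term.var (ρ x)) (fun x => Term.var (τ (ρ.symm x))) =
      (fun x => Term.var (τ x) : ℕ → L.Term ℕ) := by
    funext x
    simp [comp, Term.subst]
  refine ⟨fun x => Term.var (τ (ρ.symm x)), ?_, ?_⟩
  · rw [h1, Atom.subst_subst, h3, this]
  · rw [h2, inst_inst, h4, this]

theorem Clause.exists_variant_disjoint (c : Clause L) {F : Set ℕ} (hF : F.Finite) :
    ∃ d, c.IsVariant d ∧ Disjoint d.vars F := by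
  obtain ⟨N, hN⟩ := hF.bddAbove
  obtain ⟨ρ, hρ⟩ := exists_perm_eqOn c.finite_vars (f := fun x => x + (N + 1))
    (fun x _ y _ h => by simpa using h)
  refine ⟨⟨c.head.rename ρ, c.body.map fun A => A.rename ρ⟩, ⟨ρ, rfl, rfl⟩, ?_⟩
  rw [Set.disjoint_left]
  have key : ∀ x ∈ c.vars, ∀ y, y ∈ ((Term.var (ρ x) : L.Term ℕ)).varFinset → y ∉ F := by
    intro x hx y hy hyF
    simp only [Term.varFinset, Finset.mem_singleton] at hy
    have := hN hyF
    rw [hy, hρ x hx] at this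
    omega
  rintro y (hy | hy)
  · obtain ⟨x, hx, hy⟩ := Atom.mem_vars_subst.1 hy
    exact key x (Or.inl hx) y hy
  · obtain ⟨x, hx, hy⟩ := mem_queryVars_inst.1 hy
    exact key x (Or.inr hx) y hy

/-- The composite of `f` and `g` fixes the variables of `A`. Hence `f` sends these variables to
variables, injectively, and agrees on them with a permutation. -/
theorem Atom.isVariant_of_subst {A B : Atom L} {f g : ℕ → L.Term ℕ} (h1 : B = A.subst f)
    (h2 : A = B.subst g) : A.IsVariant B := by
  have h : ∀ x ∈ A.vars, (f x).subst g = Term.var x := by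
    have := h2
    rw [h1, Atom.subst_subst] at this
    nth_rewrite 1 [← A.subst_var] at this
    exact fun x hx => (Atom.subst_congr_iff.1 this x hx).symm
  have hvar : ∀ x, ∃ y, x ∈ A.vars → f x = Term.var y := by
    intro x
    by_cases hx : x ∈ A.vars
    · have := h x hx
      rcases hfx : f x with y | ⟨F, ts⟩
      · exact ⟨y, fun _ => rfl⟩
      · rw [hfx] at this
        cases this
    · exact ⟨0, fun h => absurd h hx⟩
  choose k hk using hvar
  obtain ⟨ρ, hρ⟩ := exists_perm_eqOn A.finite_vars (f := k) (by
    intro x hx y hy hxy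
    have h1 := h x hx
    have h2 := h y hy
    rw [hk x hx, hxy, ← hk y hy, h2] at h1
    exact (Term.var.inj h1).symm)
  refine ⟨ρ, ?_⟩
  rw [h1]
  exact Atom.subst_congr_iff.2 fun x hx => by rw [hρ x hx, hk x hx]

/-! ### Unification -/

/-- The number of symbols of a term. -/
def termSize : L.Term ℕ → ℕ
  | .var _ => 1
  | .func _ ts => 1 + ∑ i, termSize (ts i)

theorem termSize_pos (t : L.Term ℕ) : 0 < termSize t := by
  cases t <;> simp [termSize]

/-- The occurs check: a variable properly inside a term cannot be solved by that term, since sizes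
would differ. -/
theorem termSize_le_subst {t : L.Term ℕ} {f : ℕ → L.Term ℕ} {x : ℕ} (hx : x ∈ t.varFinset) :
    t = Term.var x ∨ termSize (f x) < termSize (t.subst f) := by
  induction t with
  | var y =>
    simp only [Term.varFinset, Finset.mem_singleton] at hx
    exact Or.inl (by rw [hx])
  | func F ts ih =>
    right
    simp only [Term.varFinset, Finset.mem_biUnion, Finset.mem_univ, true_and] at hx
    obtain ⟨i, hi⟩ := hx
    have h1 : termSize (f x) ≤ termSize ((ts i).subst f) := by
      rcases ih i hi with h | h
      · rw [h]; rfl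
      · exact h.le
    have h2 := Finset.single_le_sum (f := fun i => termSize ((ts i).subst f))
      (fun _ _ => Nat.zero_le _) (Finset.mem_univ i)
    simp only [Term.subst, termSize] at h2 ⊢
    omega

/-- The map `f` solves every equation of the list. -/
def Solves (f : ℕ → L.Term ℕ) (E : List (L.Term ℕ × L.Term ℕ)) : Prop :=
  ∀ e ∈ E, e.1.subst f = e.2.subst f

def eqVars (E : List (L.Term ℕ × L.Term ℕ)) : Set ℕ :=
  {x | ∃ e ∈ E, x ∈ e.1.varFinset ∨ x ∈ e.2.varFinset}

/-- `θ` is a most general solution of `E` that involves only variables of `E`. -/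
structure IsRelevantSolution (θ : Subst L) (E : List (L.Term ℕ × L.Term ℕ)) : Prop where
  solves : Solves θ E
  vars_subset : θ.vars ⊆ eqVars E
  most_general : ∀ η : ℕ → L.Term ℕ, Solves η E → ∀ x, (θ x).subst η = η x

theorem IsRelevantSolution.of_solves_iff {θ : Subst L} {E E' : List (L.Term ℕ × L.Term ℕ)}
    (h : IsRelevantSolution θ E') (hv : eqVars E' ⊆ eqVars E)
    (hs : ∀ f : ℕ → L.Term ℕ, Solves f E ↔ Solves f E') : IsRelevantSolution θ E :=
  ⟨(hs _).2 h.solves, h.vars_subset.trans hv, fun η hη => h.most_general η ((hs η).1 hη)⟩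

/-- Replacement of one variable by a term. -/
def single (x : ℕ) (t : L.Term ℕ) : ℕ → L.Term ℕ := fun y => if y = x then t else Term.var y

theorem comp_single {x : ℕ} {t : L.Term ℕ} {f : ℕ → L.Term ℕ} (h : f x = t.subst f) :
    comp (single x t) f = f := by
  funext y
  by_cases hy : y = x
  · simp [comp, single, hy, h]
  · simp [comp, single, hy, Term.subst]

def substEqs (E : List (L.Term ℕ × L.Term ℕ)) (f : ℕ → L.Term ℕ) : List (L.Term ℕ × L.Term ℕ) :=
  E.map fun e => (e.1.subst f, e.2.subst f)

theorem solves_substEqs {E : List (L.Term ℕ × L.Term ℕ)} {f g : ℕ → L.Term ℕ} :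
    Solves g (substEqs E f) ↔ Solves (comp f g) E := by
  simp only [Solves, substEqs, List.forall_mem_map, term_subst_subst]
  rfl

/-- Every solution of the equation for `x` absorbs the replacement of `x` by `t`, so solving the
replaced equations after this replacement is most general. -/
theorem IsRelevantSolution.eliminate {θ : Subst L} {E : List (L.Term ℕ × L.Term ℕ)} {x : ℕ}
    {t : L.Term ℕ} (hx : x ∉ t.varFinset) (h : IsRelevantSolution θ (substEqs E (single x t))) :
    ∃ θ' : Subst L, IsRelevantSolution θ' ((Term.var x, t) :: E) := by
  have hE : eqVars (substEqs E (single x t)) ⊆ eqVars ((Term.var x, t) :: E) := by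
    have key : ∀ (s : L.Term ℕ) (y : ℕ), y ∈ (s.subst (single x t)).varFinset →
        y ∈ s.varFinset ∨ y ∈ t.varFinset := by
      intro s y hy
      obtain ⟨z, hz, hy⟩ := mem_varFinset_subst.1 hy
      by_cases hzx : z = x
      · rw [single, if_pos hzx] at hy
        exact Or.inr hy
      · simp only [single, if_neg hzx, Term.varFinset, Finset.mem_singleton] at hy
        exact Or.inl (hy ▸ hz)
    rintro y ⟨_, he', hy⟩
    obtain ⟨e, he, rfl⟩ := List.mem_map.1 he'
    have : (y ∈ e.1.varFinset ∨ y ∈ e.2.varFinset) ∨ y ∈ t.varFinset := by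
      rcases hy with hy | hy
      · exact (key _ _ hy).imp_left Or.inl
      · exact (key _ _ hy).imp_left Or.inr
    rcases this with h | h
    · exact ⟨e, List.mem_cons_of_mem _ he, h⟩
    · exact ⟨_, List.mem_cons_self, Or.inr h⟩
  have hxE : x ∈ eqVars ((Term.var x, t) :: E) :=
    ⟨_, List.mem_cons_self, Or.inl (by simp [Term.varFinset])⟩
  have htE : ∀ y ∈ t.varFinset, y ∈ eqVars ((Term.var x, t) :: E) :=
    fun y hy => ⟨_, List.mem_cons_self, Or.inr hy⟩
  have hmoved : ∀ y, comp (single x t) θ y ≠ Term.var y → y = x ∨ θ y ≠ Term.var y := by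
    intro y hy
    by_cases hyx : y = x
    · exact Or.inl hyx
    · right
      simpa [comp, single, hyx, Term.subst] using hy
  refine ⟨⟨comp (single x t) θ, ?_⟩, ?_, ?_, ?_⟩
  · refine (θ.finite_support.union (Set.finite_singleton x)).subset fun y hy => ?_
    exact (hmoved y hy).symm
  · have ht : t.subst (comp (single x t) θ) = t.subst θ := term_subst_congr_iff.2 fun y hy => by
      have : y ≠ x := fun h => hx (h ▸ hy)
      simp [comp, single, this, Term.subst]
    intro e he
    rcases List.mem_cons.1 he with rfl | he
    · simp only [ht]
      simp [comp, single, Term.subst]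
    · exact solves_substEqs.1 h.solves e he
  · rintro y (hy | ⟨z, hz, hy⟩)
    · rcases hmoved y hy with rfl | hy
      · exact hxE
      · exact hE (h.vars_subset (Or.inl hy))
    · by_cases hzx : z = x
      · simp only [comp, single, hzx, if_true] at hy
        obtain ⟨w, hw, hy⟩ := mem_varFinset_subst.1 hy
        rcases Subst.mem_of_mem_apply hy with rfl | hy
        · exact htE _ hw
        · exact hE (h.vars_subset hy)
      · have hz' := (hmoved z hz).resolve_left hzx
        simp only [comp, single, if_neg hzx, Term.subst] at hy
        exact hE (h.vars_subset (Or.inr ⟨z, hz', hy⟩))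
  · intro η hη y
    have hxη : η x = t.subst η := hη _ List.mem_cons_self
    have hcomp := comp_single hxη
    have hθη : comp θ η = η := funext <| h.most_general η (solves_substEqs.2 (by
      rw [hcomp]
      exact fun e he => hη e (List.mem_cons_of_mem _ he)))
    change ((single x t y).subst θ).subst η = η y
    rw [term_subst_subst]
    change (single x t y).subst (comp θ η) = η y
    rw [hθη]
    exact congrFun hcomp y

/-- Unification by elimination and decomposition. The known solution `η` supplies the measure, the
total size of the left sides under `η`: eliminating a variable leaves the sizes of the other
equations unchanged and drops one equation, and decomposing removes a function symbol. -/
theorem exists_isRelevantSolution (η : ℕ → L.Term ℕ) (n : ℕ)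
    (E : List (L.Term ℕ × L.Term ℕ)) (hη : Solves η E)
    (hn : (E.map fun e => termSize (e.1.subst η)).sum = n) :
    ∃ θ : Subst L, IsRelevantSolution θ E := by
  induction n using Nat.strong_induction_on generalizing E with
  | _ n ih =>
  have elim : ∀ (x : ℕ) (t : L.Term ℕ) (E' : List (L.Term ℕ × L.Term ℕ)),
      Solves η ((Term.var x, t) :: E') →
      (((Term.var x, t) :: E').map fun e => termSize (e.1.subst η)).sum = n →
      ∃ θ : Subst L, IsRelevantSolution θ ((Term.var x, t) :: E') := by
    intro x t E' hη hn
    have hx : η x = t.subst η := hη _ List.mem_cons_self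
    have hη' : Solves η E' := fun e he => hη e (List.mem_cons_of_mem _ he)
    simp only [List.map_cons, List.sum_cons] at hn
    have hpos := termSize_pos ((Term.var x : L.Term ℕ).subst η)
    by_cases hxt : x ∈ t.varFinset
    · rcases termSize_le_subst (f := η) hxt with rfl | hlt
      · obtain ⟨θ, hθ⟩ := ih _ (by omega) E' hη' rfl
        refine ⟨θ, hθ.of_solves_iff ?_ ?_⟩
        · rintro y ⟨e, he, hy⟩
          exact ⟨e, List.mem_cons_of_mem _ he, hy⟩
        · intro f
          simp [Solves]
      · rw [hx] at hlt
        exact absurd hlt (lt_irrefl _)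
    · obtain ⟨θ, hθ⟩ := ih (E'.map fun e => termSize (e.1.subst η)).sum (by omega)
        (substEqs E' (single x t)) (by
          rw [solves_substEqs, comp_single hx]; exact hη') (by
          simp only [substEqs, List.map_map, Function.comp_def, term_subst_subst]
          change (E'.map fun e => termSize (e.1.subst (comp (single x t) η))).sum = _
          rw [comp_single hx])
      exact hθ.eliminate hxt
  match E, hη, hn with
  | [], hη, hn =>
    refine ⟨⟨Term.var, by simp⟩, by simp [Solves], ?_, fun η _ x => rfl⟩
    rintro y (hy | ⟨x, hx, -⟩)
    · exact absurd rfl hy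
    · exact absurd rfl hx
  | (.var x, t) :: E', hη, hn => exact elim x t E' hη hn
  -- Swapping the two sides does not lower the measure, so `elim` is applied directly to the swapped
  -- equation.
  | (.func F ts, .var x) :: E', hη, hn =>
    obtain ⟨θ, hθ⟩ := elim x (.func F ts) E' (by
        intro e he
        rcases List.mem_cons.1 he with rfl | he
        · exact (hη _ List.mem_cons_self).symm
        · exact hη e (List.mem_cons_of_mem _ he)) (by
        rw [← hn]
        simp only [List.map_cons, hη _ List.mem_cons_self])
    refine ⟨θ, hθ.of_solves_iff ?_ ?_⟩
    · rintro y ⟨e, he, hy⟩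
      rcases List.mem_cons.1 he with rfl | he
      · exact ⟨_, List.mem_cons_self, hy.symm⟩
      · exact ⟨e, List.mem_cons_of_mem _ he, hy⟩
    · intro f
      simp only [Solves, List.forall_mem_cons]
      exact and_congr_left' eq_comm
  | (.func (l := l) F ts, .func (l := l') G us) :: E', hη, hn =>
    have h0 : (Term.func F fun i => (ts i).subst η) = Term.func G fun i => (us i).subst η :=
      hη _ List.mem_cons_self
    obtain rfl : l = l' := (Term.func.inj h0).1
    obtain ⟨-, hFG, hargs⟩ := Term.func.inj h0
    obtain rfl := eq_of_heq hFG
    have hsolves : ∀ f : ℕ → L.Term ℕ, Solves f ((Term.func F ts, Term.func F us) :: E') ↔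
        Solves f (List.ofFn (fun i => (ts i, us i)) ++ E') := by
      intro f
      simp only [Solves, List.forall_mem_cons, List.forall_mem_append, List.forall_mem_ofFn_iff,
        Term.subst, Term.func.injEq, heq_eq_eq, true_and, funext_iff]
    simp only [List.map_cons, List.sum_cons, Term.subst, termSize] at hn
    obtain ⟨θ, hθ⟩ := ih _ (by
        rw [List.map_append, List.sum_append, List.map_ofFn, List.sum_ofFn]
        simp only [Function.comp_def]
        omega) _ ((hsolves η).1 hη) rfl
    refine ⟨θ, hθ.of_solves_iff ?_ hsolves⟩
    rintro y ⟨e, he, hy⟩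
    rcases List.mem_append.1 he with he | he
    · obtain ⟨i, rfl⟩ := List.mem_ofFn.1 he
      refine ⟨_, List.mem_cons_self, ?_⟩
      simp only [Term.varFinset, Finset.mem_biUnion, Finset.mem_univ, true_and]
      exact hy.imp (fun h => ⟨i, h⟩) fun h => ⟨i, h⟩
    · exact ⟨e, List.mem_cons_of_mem _ he, hy⟩

/-- Unifiable atoms have a most general unifier that involves only their variables. -/
theorem exists_isMGU {A B : Atom L} {η : ℕ → L.Term ℕ} (h : A.subst η = B.subst η) :
    ∃ θ : Subst L, IsMGU θ A B ∧ θ.vars ⊆ A.vars ∪ B.vars := by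
  obtain ⟨p, as⟩ := A
  obtain ⟨q, bs⟩ := B
  obtain rfl : p = q := congrArg Atom.pred h
  have key : ∀ f : ℕ → L.Term ℕ, (Atom.mk p as).subst f = (Atom.mk p bs).subst f ↔
      Solves f (List.ofFn fun i => (as i, bs i)) := by
    intro f
    simp only [Atom.subst, Atom.mk.injEq, heq_eq_eq, true_and, funext_iff, Solves,
      List.forall_mem_ofFn_iff]
  obtain ⟨θ, hθ⟩ := exists_isRelevantSolution η _ _ ((key η).1 h) rfl
  refine ⟨θ, ⟨(key θ).2 hθ.solves, fun ε hε => ⟨ε, fun x => ?_⟩⟩, hθ.vars_subset.trans ?_⟩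
  · exact (hθ.most_general ε ((key ε).1 hε) x).symm
  · rintro y ⟨e, he, hy⟩
    obtain ⟨i, rfl⟩ := List.mem_ofFn.1 he
    exact hy.imp (fun h => ⟨i, h⟩) fun h => ⟨i, h⟩

/-! ### Instances and equivalence of queries -/

def IsInstance (Q R : Query L) : Prop := ∃ f : ℕ → L.Term ℕ, Q = inst R f

theorem IsInstance.refl (Q : Query L) : IsInstance Q Q := ⟨_, (inst_var Q).symm⟩

theorem IsInstance.trans {Q R T : Query L} (h1 : IsInstance Q R) (h2 : IsInstance R T) :
    IsInstance Q T := by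
  obtain ⟨f, rfl⟩ := h1
  obtain ⟨g, rfl⟩ := h2
  exact ⟨_, inst_inst _ _ _⟩

/-- Two queries are equivalent if each is an instance of the other. -/
def Equivalent (Q R : Query L) : Prop := IsInstance Q R ∧ IsInstance R Q

theorem Equivalent.symm {Q R : Query L} (h : Equivalent Q R) : Equivalent R Q := And.symm h

theorem Equivalent.refl (Q : Query L) : Equivalent Q Q := ⟨IsInstance.refl Q, IsInstance.refl Q⟩

theorem Atom.IsVariant.equivalent {A B : Atom L} (h : A.IsVariant B) : Equivalent [A] [B] := by
  have key : ∀ {A B : Atom L}, A.IsVariant B → IsInstance [B] [A] := by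
    rintro A _ ⟨ρ, rfl⟩
    exact ⟨fun x => Term.var (ρ x), rfl⟩
  exact ⟨key ((variantSetoid L).iseqv.symm h), key h⟩

theorem Equivalent.head_isVariant {A B : Atom L} {Q R : Query L}
    (h : Equivalent (A :: Q) (B :: R)) : A.IsVariant B := by
  obtain ⟨⟨f, hf⟩, ⟨g, hg⟩⟩ := h
  exact Atom.isVariant_of_subst (List.cons.inj hg).1 (List.cons.inj hf).1

/-- `Q` is an instance of a prefix of `R`. -/
def IsPrefixInstance (Q R : Query L) : Prop := ∃ R₁ R₂, R = R₁ ++ R₂ ∧ IsInstance Q R₁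

theorem IsInstance.isPrefixInstance {Q R : Query L} (h : IsInstance Q R) : IsPrefixInstance Q R :=
  ⟨R, [], by simp, h⟩

theorem IsPrefixInstance.trans {Q R T : Query L} (h1 : IsPrefixInstance Q R)
    (h2 : IsPrefixInstance R T) : IsPrefixInstance Q T := by
  obtain ⟨R₁, R₂, rfl, h1⟩ := h1
  obtain ⟨T₁, T₂, rfl, f, hf⟩ := h2
  obtain ⟨U₁, U₂, rfl, h3, h4⟩ := List.append_eq_map_iff.1 hf
  exact ⟨U₁, U₂ ++ T₂, by simp, h1.trans ⟨f, h3.symm⟩⟩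

/-! ### Resolution of a query with a clause -/

/-- Resolution of the leftmost atom with a variant of `c` that is apart from the query. -/
inductive ResolvesWith (c : Clause L) : Query L → Query L → Prop
  | intro {A : Atom L} {R : Query L} {d : Clause L} {θ : Subst L} (variant : c.IsVariant d)
      (apart : Disjoint d.vars (queryVars (A :: R))) (mgu : IsMGU θ A d.head) :
      ResolvesWith c (A :: R) (inst (d.body ++ R) θ)

/-- Generality in `IsMGU` concerns finitely supported substitutions only, so `η` is first cut down
to the finitely many variables that matter. -/
theorem IsMGU.isInstance {θ : Subst L} {A B : Atom L} (h : IsMGU θ A B) {η : ℕ → L.Term ℕ}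
    (hη : A.subst η = B.subst η) (Q : Query L) : IsInstance (inst Q η) (inst Q θ) := by
  obtain ⟨η', hη'⟩ := exists_subst_eqOn
    ((A.finite_vars.union B.finite_vars).union (finite_queryVars Q)) η
  obtain ⟨γ, hγ⟩ := h.2 η' (by
    rw [Atom.subst_congr_iff.2 fun x hx => hη' x (Or.inl (Or.inl hx)), hη]
    exact (Atom.subst_congr_iff.2 fun x hx => hη' x (Or.inl (Or.inr hx))).symm)
  refine ⟨γ, ?_⟩
  rw [inst_inst, inst_congr_iff]
  intro x hx
  rw [← hη' x (Or.inr hx), hγ x]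
  rfl

/-- A resolution step of an instance of a query is an instance of a resolution of the query,
for every choice of the input clause. -/
theorem ResolvesWith.lift {c d : Clause L} {A : Atom L} {X Q Q' : Query L}
    (h : ResolvesWith c Q Q') (hQ : IsInstance Q (A :: X)) (hd : c.IsVariant d)
    (hdis : Disjoint d.vars (queryVars (A :: X))) :
    ∃ η : ℕ → L.Term ℕ, A.subst η = d.head.subst η ∧ Q' = inst (d.body ++ X) η := by
  classical
  obtain ⟨f, hf⟩ := hQ
  cases h with
  | @intro B R e θ he hedis hθ =>
    obtain ⟨rfl, rfl⟩ := List.cons.inj hf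
    obtain ⟨g, hg1, hg2⟩ := hd.exists_map he
    -- Being apart, the clause and the query can be instantiated independently; the unifier `θ` of
    -- the given step then follows.
    let η : ℕ → L.Term ℕ := fun x => if x ∈ d.vars then g x else f x
    have hηd : ∀ x ∈ d.vars, η x = g x := fun x hx => if_pos hx
    have hηQ : ∀ x ∈ queryVars (A :: X), η x = f x :=
      fun x hx => if_neg fun h => Set.disjoint_left.1 hdis h hx
    have hA : A.subst η = A.subst f :=
      Atom.subst_congr_iff.2 fun x hx => hηQ x (by simp [hx])
    have hX : inst X η = inst X f := inst_congr_iff.2 fun x hx => hηQ x (by simp [hx])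
    have hhead : d.head.subst η = d.head.subst g :=
      Atom.subst_congr_iff.2 fun x hx => hηd x (Or.inl hx)
    have hbody : inst d.body η = inst d.body g :=
      inst_congr_iff.2 fun x hx => hηd x (Or.inr hx)
    refine ⟨comp η θ, ?_, ?_⟩
    · rw [← Atom.subst_subst, ← Atom.subst_subst, hA, hhead, ← hg1, hθ.1]
    · rw [← inst_inst, inst_append d.body, hX, hbody, ← hg2, inst_append, inst_append]
      rfl

theorem ResolvesWith.isInstance {c : Clause L} {Q Q' R R' : Query L} (hQ : ResolvesWith c Q Q')
    (hR : ResolvesWith c R R') (h : IsInstance Q R) : IsInstance Q' R' := by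
  cases hR with
  | intro variant apart mgu =>
    obtain ⟨η, h1, rfl⟩ := hQ.lift h variant apart
    exact mgu.isInstance h1 _

theorem ResolvesWith.equivalent {c : Clause L} {Q Q' R R' : Query L} (hQ : ResolvesWith c Q Q')
    (hR : ResolvesWith c R R') (h : Equivalent Q R) : Equivalent Q' R' :=
  ⟨hQ.isInstance hR h.1, hR.isInstance hQ h.2⟩

/-- Supplies the freedom needed later: the clause avoids any finite set of variables and the unifier
introduces no new ones. -/
theorem ResolvesWith.exists_mgu {c : Clause L} {A : Atom L} {X Q Q' : Query L}
    (h : ResolvesWith c Q Q') (hQ : IsInstance Q (A :: X)) {F : Set ℕ} (hF : F.Finite) :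
    ∃ (d : Clause L) (θ : Subst L), c.IsVariant d ∧ Disjoint d.vars (queryVars (A :: X)) ∧
      Disjoint d.vars F ∧ IsMGU θ A d.head ∧ θ.vars ⊆ A.vars ∪ d.vars := by
  obtain ⟨d, hd, hdis⟩ := c.exists_variant_disjoint (hF.union (finite_queryVars (A :: X)))
  rw [Set.disjoint_union_right] at hdis
  obtain ⟨η, h1, -⟩ := h.lift hQ hd hdis.2
  obtain ⟨θ, hθ, hvars⟩ := exists_isMGU h1
  exact ⟨d, θ, hd, hdis.2, hdis.1, hθ,
    hvars.trans (Set.union_subset_union_right _ Set.subset_union_left)⟩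

theorem IsInstance.eq_cons {A : Atom L} {R T : Query L} (h : IsInstance (A :: R) T) :
    ∃ B X, T = B :: X := by
  obtain ⟨f, hf⟩ := h
  cases T with
  | nil => simp at hf
  | cons B X => exact ⟨B, X, rfl⟩

/-! ### Resolution with a program -/

def Resolves (P : Program L) (Q Q' : Query L) : Prop := ∃ c ∈ P, ResolvesWith c Q Q'

def Terminates (P : Program L) : Query L → Prop := Acc fun Q' Q => Resolves P Q Q'

abbrev Reaches (P : Program L) : Query L → Query L → Prop := Relation.ReflTransGen (Resolves P)

abbrev ReachesPos (P : Program L) : Query L → Query L → Prop := Relation.TransGen (Resolves P)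

/-- Only the leftmost atom is selected, so the atoms beyond the prefix are carried along, once the
input clause is also apart from them. -/
theorem Resolves.simulate {P : Program L} {Q Q' R : Query L} (h : Resolves P Q Q')
    (hQR : IsPrefixInstance Q R) : ∃ R', Resolves P R R' ∧ IsPrefixInstance Q' R' := by
  obtain ⟨c, hc, h⟩ := h
  obtain ⟨R₁, R₂, rfl, hinst⟩ := hQR
  obtain ⟨A, X, rfl⟩ : ∃ B X, R₁ = B :: X := by
    cases h
    exact hinst.eq_cons
  obtain ⟨d, θ, hd, hdis, hdis2, hθ, -⟩ := h.exists_mgu hinst (finite_queryVars R₂)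
  refine ⟨inst (d.body ++ (X ++ R₂)) θ, ⟨c, hc, ⟨hd, ?_, hθ⟩⟩, inst (d.body ++ X) θ, inst R₂ θ,
    by simp, h.isInstance ⟨hd, hdis, hθ⟩ hinst⟩
  simp only [List.append_eq, queryVars_cons, queryVars_append, Set.disjoint_union_right] at hdis ⊢
  exact ⟨hdis.1, hdis.2, hdis2⟩

theorem Reaches.simulate {P : Program L} {Q Q' R : Query L} (h : Reaches P Q Q')
    (hQR : IsPrefixInstance Q R) : ∃ R', Reaches P R R' ∧ IsPrefixInstance Q' R' := by
  induction h with
  | refl => exact ⟨R, .refl, hQR⟩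
  | tail _ h ih =>
    obtain ⟨R', h1, h2⟩ := ih
    obtain ⟨R'', h3, h4⟩ := h.simulate h2
    exact ⟨R'', h1.tail h3, h4⟩

theorem ReachesPos.simulate {P : Program L} {Q Q' R : Query L} (h : ReachesPos P Q Q')
    (hQR : IsPrefixInstance Q R) : ∃ R', ReachesPos P R R' ∧ IsPrefixInstance Q' R' := by
  obtain ⟨T, h1, h2⟩ := Relation.TransGen.head'_iff.1 h
  obtain ⟨T', h3, h4⟩ := h1.simulate hQR
  obtain ⟨R', h5, h6⟩ := Reaches.simulate h2 h4
  exact ⟨R', Relation.TransGen.head' h3 h5, h6⟩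

theorem Terminates.of_isPrefixInstance {P : Program L} {Q R : Query L} (hR : Terminates P R)
    (h : IsPrefixInstance Q R) : Terminates P Q := by
  induction hR generalizing Q with
  | intro R _ ih =>
    refine ⟨_, fun Q' hQ' => ?_⟩
    obtain ⟨R', h1, h2⟩ := Resolves.simulate hQ' h
    exact ih R' h1 h2

theorem Terminates.of_reaches {P : Program L} {Q R : Query L} (hQ : Terminates P Q)
    (h : Reaches P Q R) : Terminates P R := by
  induction h with
  | refl => exact hQ
  | tail _ h ih => exact ih.inv h

theorem terminates_nil (P : Program L) : Terminates P [] := by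
  refine ⟨_, fun Q' h => ?_⟩
  obtain ⟨c, -, h⟩ := h
  cases h

/-! ### Resolution inside a context -/

/-- Resolution of the first component of a pair of queries, the unifier being applied to both. -/
inductive PairStep (P : Program L) : Query L × Query L → Query L × Query L → Prop
  | intro {c d : Clause L} {A : Atom L} {T R : Query L} {θ : Subst L} (mem : c ∈ P)
      (variant : c.IsVariant d) (apart : Disjoint d.vars (queryVars (A :: (T ++ R))))
      (mgu : IsMGU θ A d.head) :
      PairStep P (A :: T, R) (inst (d.body ++ T) θ, inst R θ)

theorem PairStep.resolves {P : Program L} {p q : Query L × Query L} (h : PairStep P p q) :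
    Resolves P (p.1 ++ p.2) (q.1 ++ q.2) := by
  cases h with
  | @intro c d A T R θ mem variant apart mgu =>
    refine ⟨c, mem, ?_⟩
    have := ResolvesWith.intro variant apart mgu
    rw [← List.append_assoc, inst_append] at this
    exact this

/-- The border between the two components only marks where the resolution is regarded as finished,
so it may be moved to the right. -/
theorem PairStep.shift {P : Program L} {p q : Query L × Query L} (h : PairStep P p q) (n : ℕ) :
    PairStep P (p.1 ++ p.2.take n, p.2.drop n) (q.1 ++ q.2.take n, q.2.drop n) := by
  cases h with
  | @intro c d A T R θ mem variant apart mgu =>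
    have := PairStep.intro (T := T ++ R.take n) (R := R.drop n) mem variant
      (by rwa [List.append_assoc, List.take_append_drop]) mgu
    simpa only [inst, List.map_append, List.map_take, List.map_drop, List.append_assoc,
      List.cons_append] using this

/-- While atoms of `Q` remain, each step is a step of `Q` that drags `R` along, and these are
bounded by accessibility of `Q`. Afterwards only an instance of `R` is left. -/
theorem Terminates.append {P : Program L} {Q : Query L} (hQ : Terminates P Q) (R : Query L)
    (h : ∀ R', Relation.ReflTransGen (PairStep P) (Q, R) ([], R') → Terminates P R') :
    Terminates P (Q ++ R) := by
  induction hQ generalizing R with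
  | intro Q _ ih =>
    cases Q with
    | nil => exact h R .refl
    | cons A T =>
      refine ⟨_, fun Q' hQ' => ?_⟩
      obtain ⟨c, hc, hQ'⟩ := hQ'
      cases hQ' with
      | @intro _ _ d θ variant apart mgu =>
        rw [List.append_eq, ← List.append_assoc, inst_append]
        refine ih (inst (d.body ++ T) θ) ⟨c, hc, variant, ?_, mgu⟩ _ fun R' hR' => ?_
        · simp only [List.append_eq, queryVars_cons, queryVars_append, Set.disjoint_union_right]
            at apart ⊢
          exact ⟨apart.1, apart.2.1⟩
        · exact h R' (.head (.intro hc variant apart mgu) hR')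

/-! ### LD-derivations as sequences of resolution steps -/

/-- The variables of the input clauses and unifiers of a derivation. -/
def stepsVars (ss : List (Step L)) : Set ℕ := {x | ∃ s ∈ ss, x ∈ s.input.vars ∪ s.mgu.vars}

theorem finite_stepsVars (ss : List (Step L)) : (stepsVars ss).Finite := by
  have : stepsVars ss = ⋃ s ∈ {s | s ∈ ss}, (s.input.vars ∪ s.mgu.vars) := by
    ext; simp [stepsVars]
  rw [this]
  exact (List.finite_toSet ss).biUnion fun s _ => s.input.finite_vars.union s.mgu.finite_vars

theorem stepsVars_cons (s : Step L) (ss : List (Step L)) :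
    stepsVars (s :: ss) = (s.input.vars ∪ s.mgu.vars) ∪ stepsVars ss := by
  ext; simp [stepsVars]

theorem LDDeriv.queryVars_subset {P : Program L} {Q M : Query L} {ss : List (Step L)}
    (h : LDDeriv P Q ss M) : queryVars M ⊆ queryVars Q ∪ stepsVars ss := by
  induction h with
  | nil => exact Set.subset_union_left
  | @step ss A R s _ _ _ _ _ _ ih =>
    intro x hx
    rw [stepsVars_cons]
    rcases queryVars_inst_subset _ _ hx with hx | hx
    · rw [queryVars_append] at hx
      rcases hx with hx | hx
      · exact Or.inr (Or.inl (Or.inl (Or.inr hx)))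
      · rcases ih (by rw [queryVars_cons]; exact Or.inr hx) with hx | hx
        · exact Or.inl hx
        · exact Or.inr (Or.inr hx)
    · exact Or.inr (Or.inl (Or.inr hx))

/-- Global standardization apart implies the local one, since the variables of the current query
come from the initial query and the earlier steps. -/
theorem LDDeriv.exists_tail {P : Program L} {Q M : Query L} {s : Step L} {ss : List (Step L)}
    (h : LDDeriv P Q (s :: ss) M) :
    s.clause ∈ P ∧ ∃ M₀, LDDeriv P Q ss M₀ ∧ ResolvesWith s.clause M₀ M := by
  cases h with
  | step _ prev mem variant apart_query apart_steps mgu =>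
    refine ⟨mem, _, prev, variant, ?_, mgu⟩
    refine Disjoint.mono_right prev.queryVars_subset (Set.disjoint_union_right.2 ⟨apart_query, ?_⟩)
    rw [Set.disjoint_right]
    rintro x ⟨s', hs', hx | hx⟩
    · exact Set.disjoint_right.1 (apart_steps s' hs').1 hx
    · exact Set.disjoint_right.1 (apart_steps s' hs').2 hx

theorem LDDeriv.unique {P : Program L} {Q M M' : Query L} {ss : List (Step L)}
    (h : LDDeriv P Q ss M) (h' : LDDeriv P Q ss M') : M = M' := by
  induction h generalizing M' with
  | nil =>
    cases h'
    rfl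
  | step s _ _ _ _ _ _ ih =>
    cases h' with
    | step _ prev =>
      obtain ⟨-, rfl⟩ := List.cons.inj (ih prev)
      rfl

theorem LDDeriv.reaches {P : Program L} {Q M : Query L} {ss : List (Step L)}
    (h : LDDeriv P Q ss M) : Reaches P Q M := by
  induction ss generalizing M with
  | nil =>
    cases h
    exact .refl
  | cons s ss ih =>
    obtain ⟨hs, M₀, h1, h2⟩ := h.exists_tail
    exact (ih h1).tail ⟨_, hs, h2⟩

/-- A derivation is extended by a clause as soon as some query of which the leftmost atom is an
instance of its leftmost atom can be resolved with the clause. -/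
theorem LDDeriv.extend {P : Program L} {Q R X N N' : Query L} {A : Atom L} {ss : List (Step L)}
    (h : LDDeriv P Q ss (A :: R)) {c : Clause L} (hc : c ∈ P) (hN : ResolvesWith c N N')
    (hinst : IsInstance N (A :: X)) {F : Set ℕ} (hF : F.Finite) :
    ∃ s : Step L, s.clause = c ∧ LDDeriv P Q (s :: ss) (inst (s.input.body ++ R) s.mgu) ∧
      c.IsVariant s.input ∧ Disjoint s.input.vars F ∧ s.mgu.vars ⊆ A.vars ∪ s.input.vars ∧
      ResolvesWith c (A :: X) (inst (s.input.body ++ X) s.mgu) := by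
  obtain ⟨d, θ, hd, hdis, hdis2, hθ, hvars⟩ := hN.exists_mgu hinst
    ((hF.union (finite_queryVars Q)).union (finite_stepsVars ss))
  simp only [Set.disjoint_union_right] at hdis2
  refine ⟨⟨c, d, θ⟩, rfl, .step ⟨c, d, θ⟩ h hc hd hdis2.1.2 (fun s hs => ?_) hθ, hd, hdis2.1.1,
    hvars, .intro hd hdis hθ⟩
  rw [← Set.disjoint_union_right]
  refine hdis2.2.mono_right ?_
  intro x hx
  exact ⟨s, hs, hx⟩

/-- A resolution sequence may reuse variables that a derivation must avoid. Redoing it with fresh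
clauses changes its queries only up to equivalence. -/
theorem LDDeriv.exists_of_reaches {P : Program L} {Q M N N' : Query L} {ss : List (Step L)}
    {M₁ M₂ : Query L} (h : LDDeriv P Q ss M) (hM : M = M₁ ++ M₂) (heq : Equivalent M₁ N)
    (hN : Reaches P N N') :
    ∃ ss' M₁' M₂', LDDeriv P Q ss' (M₁' ++ M₂') ∧ Equivalent M₁' N' := by
  induction hN with
  | refl => exact ⟨ss, M₁, M₂, hM ▸ h, heq⟩
  | tail _ hstep ih =>
    obtain ⟨ss', M₁', M₂', h', heq'⟩ := ih
    obtain ⟨c, hc, hstep⟩ := hstep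
    obtain ⟨A, X, rfl⟩ : ∃ B X, M₁' = B :: X := by
      cases hstep
      exact heq'.2.eq_cons
    obtain ⟨s, -, h1, -, -, -, h2⟩ := h'.extend hc hstep heq'.2 Set.finite_empty
    refine ⟨s :: ss', inst (s.input.body ++ X) s.mgu, inst M₂' s.mgu, ?_,
      h2.equivalent hstep heq'⟩
    simpa [inst_append] using h1

/-! ### Finiteness of LD-trees -/

theorem LDTree.mem_of_suffix {P : Program L} {Q : Query L} (T : LDTree P Q)
    {ss ts : List (Step L)} (h : ts ∈ T.nodes) (hs : ss <:+ ts) : ss ∈ T.nodes := by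
  obtain ⟨l, rfl⟩ := hs
  induction l with
  | nil => exact h
  | cons s l ih => exact ih (T.parent_mem _ _ h)

/-- A node has at most one child for each of the finitely many clauses, and the subtree under each
child is finite by induction on accessibility. -/
theorem LDTree.finite_of_terminates {P : Program L} {Q M : Query L} (T : LDTree P Q)
    (hM : Terminates P M) (ss : List (Step L)) (hss : ss ∈ T.nodes) (hd : LDDeriv P Q ss M) :
    {ts ∈ T.nodes | ss <:+ ts}.Finite := by
  induction hM generalizing ss with
  | intro M _ ih =>
  have hfin : ∀ c ∈ P, {ts ∈ T.nodes | ∃ s : Step L, s.clause = c ∧ (s :: ss) <:+ ts}.Finite := by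
    intro c hc
    by_cases hex : ∃ s : Step L, s.clause = c ∧ s :: ss ∈ T.nodes
    · obtain ⟨s, hsc, hs⟩ := hex
      obtain ⟨M', hM'⟩ := T.isDeriv _ hs
      obtain ⟨hsP, M₀, h1, h2⟩ := hM'.exists_tail
      obtain rfl := hd.unique h1
      refine (ih M' ⟨_, hsP, h2⟩ (s :: ss) hs hM').subset ?_
      rintro ts ⟨hts, s', hs'c, hs'⟩
      have := (T.children ss hss c hc ⟨s, hsc, M', hM'⟩).unique ⟨hsc, hs⟩
        ⟨hs'c, T.mem_of_suffix hts hs'⟩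
      exact ⟨hts, this ▸ hs'⟩
    · refine Set.finite_empty.subset ?_
      rintro ts ⟨hts, s, hsc, hs⟩
      exact hex ⟨s, hsc, T.mem_of_suffix hts hs⟩
  refine ((P.finite_toSet.biUnion hfin).union (Set.finite_singleton ss)).subset ?_
  rintro ts ⟨hts, l, rfl⟩
  rcases List.eq_nil_or_concat l with rfl | ⟨l, s, rfl⟩
  · exact Or.inr rfl
  · left
    have hsuf : (s :: ss) <:+ (l.concat s ++ ss) := ⟨l, by simp⟩
    obtain ⟨M', hM'⟩ := T.isDeriv _ (T.mem_of_suffix hts hsuf)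
    exact Set.mem_biUnion hM'.exists_tail.1 ⟨hts, s, rfl, hsuf⟩

theorem Terminates.ldTerminates {P : Program L} {Q : Query L} (h : Terminates P Q) :
    LDTerminates P Q := fun T =>
  (T.finite_of_terminates h [] T.root_mem .nil).subset fun _ hts => ⟨hts, List.nil_suffix⟩

theorem LDTerminates.terminates {P : Program L} {Q : Query L} (h : LDTerminates P Q) :
    Terminates P Q := by
  obtain ⟨T⟩ := nonempty_LDTree P Q
  obtain ⟨N, hN⟩ := ((h T).image List.length).bddAbove
  -- Node lengths are bounded by `N`, and `k` bounds the levels left below a node. A step outside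
  -- the tree is compared with the tree's child for the same clause.
  have key : ∀ k, ∀ ss ∈ T.nodes, ∀ M, LDDeriv P Q ss M → N < ss.length + k →
      Terminates P M := by
    intro k
    induction k with
    | zero =>
      intro ss hss M _ hlt
      exact absurd (hN ⟨ss, hss, rfl⟩) (by simpa using hlt)
    | succ k ih =>
      intro ss hss M hM hlt
      refine ⟨_, fun M' hM' => ?_⟩
      obtain ⟨c, hc, hM'⟩ := hM'
      obtain ⟨A, R, rfl⟩ : ∃ A R, M = A :: R := by
        cases hM'
        exact ⟨_, _, rfl⟩
      obtain ⟨s, hs, h1, -⟩ := hM.extend hc hM' (IsInstance.refl _) Set.finite_empty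
      obtain ⟨t, ⟨rfl, ht⟩, -⟩ := T.children ss hss c hc ⟨s, hs, _, h1⟩
      obtain ⟨M'', hM''⟩ := T.isDeriv _ ht
      obtain ⟨-, M₀, h2, h3⟩ := hM''.exists_tail
      obtain rfl := hM.unique h2
      exact (ih _ ht M'' hM'' (by simp only [List.length_cons]; omega)).of_isPrefixInstance
        (hM'.isInstance h3 (IsInstance.refl _)).isPrefixInstance
  exact key (N + 1) [] T.root_mem Q .nil (by simp)

/-! ### Computed answers -/

/-- The composition of the unifiers of a derivation. -/
def answer (ss : List (Step L)) : ℕ → L.Term ℕ := fun x => applySteps ss (Term.var x)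

theorem answer_cons (s : Step L) (ss : List (Step L)) :
    answer (s :: ss) = comp (answer ss) s.mgu := rfl

theorem answer_nil : answer ([] : List (Step L)) = Term.var := rfl

theorem answer_of_notMem {ss : List (Step L)} {x : ℕ} (h : ∀ s ∈ ss, x ∉ s.mgu.vars) :
    answer ss x = Term.var x := by
  induction ss with
  | nil => rfl
  | cons s ss ih =>
    rw [answer_cons, comp, ih fun s' hs' => h s' (List.mem_cons_of_mem _ hs')]
    exact Subst.apply_of_notMem_vars (h s List.mem_cons_self)

theorem mem_answer {ss : List (Step L)} {x y : ℕ} (h : y ∈ (answer ss x).varFinset) :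
    y = x ∨ ∃ s ∈ ss, y ∈ s.mgu.vars := by
  induction ss generalizing y with
  | nil => exact Or.inl (by simpa [answer_nil, Term.varFinset] using h)
  | cons s ss ih =>
    obtain ⟨z, hz, hy⟩ := mem_varFinset_subst.1 h
    rcases Subst.mem_of_mem_apply hy with rfl | hy
    · exact (ih hz).imp_right fun ⟨s', hs', h'⟩ => ⟨s', List.mem_cons_of_mem _ hs', h'⟩
    · exact Or.inr ⟨s, List.mem_cons_self, hy⟩

theorem LDDeriv.reaches_append {P : Program L} {Q M : Query L} {ss : List (Step L)}
    (h : LDDeriv P Q ss M) (R : Query L)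
    (hR : ∀ s ∈ ss, Disjoint s.input.vars (queryVars R)) :
    Reaches P (Q ++ R) (M ++ inst R (answer ss)) := by
  induction h with
  | nil =>
    rw [answer_nil, inst_var]
  | @step ss A T s prev mem variant apart_query apart_steps mgu ih =>
    refine (ih fun s' hs' => hR s' (List.mem_cons_of_mem _ hs')).tail ?_
    have hapart : Disjoint s.input.vars (queryVars (A :: (T ++ inst R (answer ss)))) := by
      rw [Set.disjoint_left]
      intro x hx hxQ
      rw [← List.cons_append, queryVars_append] at hxQ
      rcases hxQ with hxQ | hxQ
      · rcases prev.queryVars_subset hxQ with h | ⟨s', hs', h | h⟩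
        · exact Set.disjoint_left.1 apart_query hx h
        · exact Set.disjoint_left.1 (apart_steps s' hs').1 hx h
        · exact Set.disjoint_left.1 (apart_steps s' hs').2 hx h
      · obtain ⟨y, hy, hxy⟩ := mem_queryVars_inst.1 hxQ
        rcases mem_answer hxy with rfl | ⟨s', hs', h⟩
        · exact Set.disjoint_left.1 (hR s List.mem_cons_self) hx hy
        · exact Set.disjoint_left.1 (apart_steps s' hs').2 hx h
    have := ResolvesWith.intro variant hapart mgu
    rw [← List.append_assoc, inst_append, inst_inst] at this
    exact ⟨s.clause, mem, this⟩

theorem LDDeriv.disjoint_query {P : Program L} {Q M : Query L} {ss : List (Step L)}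
    (h : LDDeriv P Q ss M) : ∀ s ∈ ss, Disjoint s.input.vars (queryVars Q) := by
  induction h with
  | nil => simp
  | step s _ _ _ apart_query _ _ ih => exact List.forall_mem_cons.2 ⟨apart_query, ih⟩

/-- After a computed answer `σ` for `Q`, the query `Q ++ R` leads to a query more general
than `R σ`. The variables of `R` that are not in `Q` may occur in `σ`. -/
theorem IsComputedAnswer.exists_reaches {P : Program L} {Q : Query L} {σ : Subst L}
    (h : IsComputedAnswer P Q σ) (R : Query L) :
    ∃ M, Reaches P (Q ++ R) M ∧ IsPrefixInstance (inst R σ) M := by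
  classical
  obtain ⟨ss, hd, hσ, hσ'⟩ := h
  obtain ⟨N, hN⟩ := ((finite_queryVars Q).union (finite_stepsVars ss)).bddAbove
  have hlt : ∀ x ∈ queryVars Q ∪ stepsVars ss, x < N + 1 := fun x hx => Nat.lt_succ_of_le (hN hx)
  -- `f` moves the variables of `R` outside `Q` beyond all those of the derivation, so that `R` can
  -- be carried along. `g` moves them back and fixes the variables of the derivation; clashes it
  -- creates only make the result a more special instance.
  let f : ℕ → L.Term ℕ := fun y => if y ∈ queryVars Q then Term.var y else Term.var (y + (N + 1))
  let g : ℕ → L.Term ℕ := fun y => if y < N + 1 then Term.var y else Term.var (y - (N + 1))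
  have hf : ∀ {x y}, y ∈ (f x).varFinset →
      y ∈ queryVars Q ∨ N + 1 ≤ y := by
    intro x y hy
    by_cases hx : x ∈ queryVars Q
    · simp only [f, if_pos hx, Term.varFinset, Finset.mem_singleton] at hy
      exact Or.inl (hy ▸ hx)
    · simp only [f, if_neg hx, Term.varFinset, Finset.mem_singleton] at hy
      exact Or.inr (by omega)
  have hreach := hd.reaches_append (inst R f) (by
    intro s hs
    rw [Set.disjoint_left]
    intro x hx hxR
    obtain ⟨y, -, hxy⟩ := mem_queryVars_inst.1 hxR
    rcases hf hxy with hxQ | hxN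
    · exact Set.disjoint_left.1 (hd.disjoint_query s hs) hx hxQ
    · exact absurd (hlt x (Or.inr ⟨s, hs, Or.inl hx⟩)) (by omega))
  have hQR : IsInstance (Q ++ inst R f) (Q ++ R) := by
    refine ⟨f, ?_⟩
    rw [inst_append]
    congr 1
    nth_rewrite 1 [← inst_var Q]
    exact inst_congr_iff.2 fun x hx => by simp only [f, if_pos hx]
  obtain ⟨M, h1, h2⟩ := Reaches.simulate hreach hQR.isPrefixInstance
  refine ⟨M, h1, IsPrefixInstance.trans (IsInstance.isPrefixInstance ⟨g, ?_⟩) h2⟩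
  rw [List.nil_append, inst_inst, inst_inst, inst_congr_iff]
  intro x _
  by_cases hx : x ∈ queryVars Q
  · rw [hσ x hx]
    change answer ss x = (f x).subst (comp (answer ss) g)
    simp only [f, if_pos hx]
    change answer ss x = (answer ss x).subst g
    nth_rewrite 1 [← term_subst_var (answer ss x)]
    refine term_subst_congr_iff.2 fun y hy => ?_
    have : y < N + 1 := by
      rcases mem_answer hy with rfl | ⟨s, hs, h⟩
      · exact hlt _ (Or.inl hx)
      · exact hlt _ (Or.inr ⟨s, hs, Or.inr h⟩)
    simp only [g, if_pos this]
  · rw [hσ' x hx]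
    change Term.var x = (f x).subst (comp (answer ss) g)
    simp only [f, if_neg hx]
    change Term.var x = (answer ss (x + (N + 1))).subst g
    rw [answer_of_notMem fun s hs h => absurd (hlt _ (Or.inr ⟨s, hs, Or.inr h⟩)) (by omega)]
    simp only [Term.subst, g, if_neg (show ¬ x + (N + 1) < N + 1 by omega), Nat.add_sub_cancel]

theorem Clause.IsVariant.length_body {c d : Clause L} (h : c.IsVariant d) :
    d.body.length = c.body.length := by
  obtain ⟨ρ, -, h⟩ := h
  rw [← h, List.length_map]

/-- The steps are redone with clauses and unifiers that avoid `F`, so the derivation leaves the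
variables in `F` untouched. The lengths are tracked because equivalence of the concatenations does
not locate the border. -/
theorem exists_ldDeriv_of_pairStep {P : Program L} {Q R : Query L} {p : Query L × Query L}
    (h : Relation.ReflTransGen (PairStep P) (Q, R) p) {F : Set ℕ} (hF : F.Finite)
    (hFQ : Disjoint (queryVars Q) F) :
    ∃ ss M, LDDeriv P Q ss M ∧ M.length = p.1.length ∧
      Equivalent (M ++ inst R (answer ss)) (p.1 ++ p.2) ∧ Disjoint (queryVars M) F ∧
      ∀ s ∈ ss, Disjoint s.mgu.vars F := by
  induction h with
  | refl =>
    refine ⟨[], Q, .nil, rfl, ?_, hFQ, by simp⟩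
    rw [answer_nil, inst_var]
    exact .refl _
  | tail _ hstep ih =>
    obtain ⟨ss, M, hd, hlen, heq, hM, hss⟩ := ih
    have hres := hstep.resolves
    cases hstep with
    | @intro c d A T R' θ mem variant apart mgu =>
      obtain ⟨B, U, rfl⟩ := List.exists_cons_of_length_eq_add_one hlen
      have hR : ResolvesWith c ((A :: T) ++ R') (inst (d.body ++ T) θ ++ inst R' θ) := by
        have := ResolvesWith.intro variant apart mgu
        rwa [← List.append_assoc, inst_append] at this
      obtain ⟨s, -, h1, hs, h2, h3, h4⟩ := hd.extend mem hR heq.2 hF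
      rw [queryVars_cons, Set.disjoint_union_left] at hM
      have hmgu : Disjoint s.mgu.vars F := (Set.disjoint_union_left.2 ⟨hM.1, h2⟩).mono_left h3
      refine ⟨s :: ss, _, h1, ?_, ?_, ?_, ?_⟩
      · simp only [List.length_cons, length_inst, List.length_append] at hlen ⊢
        rw [hs.length_body, variant.length_body]
        omega
      · have := h4.equivalent hR heq
        rw [List.append_eq, ← List.append_assoc, inst_append, inst_inst] at this
        exact this
      · refine Disjoint.mono_left (queryVars_inst_subset _ _) ?_
        rw [queryVars_append]
        simp only [Set.disjoint_union_left]
        exact ⟨⟨h2.mono_left Set.subset_union_right, hM.2⟩, hmgu⟩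
      · exact List.forall_mem_cons.2 ⟨hmgu, hss⟩

theorem exists_isComputedAnswer {P : Program L} {Q R R' : Query L}
    (h : Relation.ReflTransGen (PairStep P) (Q, R) ([], R')) :
    ∃ σ, IsComputedAnswer P Q σ ∧ Equivalent (inst R σ) R' := by
  classical
  -- The set avoided consists of the variables of `R` outside `Q`: a computed answer is the identity
  -- there, so the unifiers must be too.
  obtain ⟨ss, M, hd, hlen, heq, -, hss⟩ := exists_ldDeriv_of_pairStep h
    ((finite_queryVars R).subset (Set.sdiff_subset (t := queryVars Q))) Set.disjoint_sdiff_right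
  obtain rfl := List.eq_nil_of_length_eq_zero hlen
  refine ⟨⟨fun x => if x ∈ queryVars Q then answer ss x else Term.var x, ?_⟩,
    ⟨ss, hd, fun x hx => if_pos hx, fun x hx => if_neg hx⟩, ?_⟩
  · refine (finite_queryVars Q).subset fun x hx => ?_
    by_contra h
    simp [h] at hx
  · rw [List.nil_append, List.nil_append] at heq
    convert heq using 1
    refine inst_congr_iff.2 fun x hx => ?_
    by_cases hxQ : x ∈ queryVars Q
    · exact if_pos hxQ
    · rw [answer_of_notMem fun s hs h => Set.disjoint_left.1 (hss s hs) h ⟨hx, hxQ⟩]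
      exact if_neg hxQ

/-! ### The call set -/

theorem mem_call_of_mem {P : Program L} {S : Set (Atom L)} {A : Atom L} (hA : A ∈ S) :
    A ∈ Call P S :=
  ⟨A, hA, [], A, [], .nil, (variantSetoid L).iseqv.refl A⟩

theorem mem_call_of_reaches {P : Program L} {S : Set (Atom L)} {A B : Atom L} {R : Query L}
    (hA : A ∈ Call P S) (h : Reaches P [A] (B :: R)) : B ∈ Call P S := by
  obtain ⟨Q, hQ, ss, A', R', hd, hvar⟩ := hA
  obtain ⟨ss', M₁, M₂, hd', heq⟩ :=
    hd.exists_of_reaches (M₁ := [A']) (M₂ := R') rfl hvar.equivalent.symm h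
  obtain ⟨C, X, rfl⟩ := heq.2.eq_cons
  exact ⟨Q, hQ, ss', C, X ++ M₂, hd', heq.symm.head_isVariant⟩

theorem terminates_of_mem_call {P : Program L} {S : Set (Atom L)}
    (hS : ∀ A ∈ S, LDTerminates P [A]) {A : Atom L} (hA : A ∈ Call P S) : Terminates P [A] := by
  obtain ⟨Q, hQ, ss, A', R, hd, hvar⟩ := hA
  exact ((hS Q hQ).terminates.of_reaches hd.reaches).of_isPrefixInstance
    ⟨[A'], R, rfl, hvar.equivalent.1⟩

/-! ### Termination implies order-acceptability -/

/-- `B` is an instance of an atom selected in a resolution sequence of positive length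
from `A`. -/
def Above (P : Program L) (A B : Atom L) : Prop := ∃ M, ReachesPos P [A] M ∧ IsPrefixInstance [B] M

theorem Above.trans {P : Program L} {A B C : Atom L} (h1 : Above P A B) (h2 : Above P B C) :
    Above P A C := by
  obtain ⟨M, hM, hB⟩ := h1
  obtain ⟨N, hN, hC⟩ := h2
  obtain ⟨N', hN', hN''⟩ := hN.simulate hB
  exact ⟨N', hM.trans hN', hC.trans hN''⟩

theorem Above.congr {P : Program L} {A A' B B' : Atom L} (h : Above P A B) (hA : A.IsVariant A')
    (hB : B.IsVariant B') : Above P A' B' := by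
  obtain ⟨M, hM, hBM⟩ := h
  obtain ⟨M', hM', hM''⟩ := hM.simulate hA.equivalent.1.isPrefixInstance
  exact ⟨M', hM', (hB.equivalent.2.isPrefixInstance.trans hBM).trans hM''⟩

/-- Each descent from `A` lifts to a resolution sequence of positive length from `Q`, so
accessibility under the transitive closure of resolution suffices. -/
theorem Terminates.acc_above {P : Program L} {Q : Query L} (hQ : Terminates P Q) {A : Atom L}
    (hA : IsPrefixInstance [A] Q) : Acc (fun B A => Above P A B) A := by
  induction Acc.transGen hQ generalizing A with
  | intro Q _ ih =>
    refine ⟨_, fun B hB => ?_⟩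
    obtain ⟨M, hM, hBM⟩ := hB
    obtain ⟨M', hM', hM''⟩ := hM.simulate hA
    have hflip := Relation.transGen_swap.2 hM'
    exact ih M' hflip (hQ.of_reaches hM'.to_reflTransGen) (hBM.trans hM'')

theorem exists_out (A : Atom L) : A.IsVariant A.cls.out :=
  (variantSetoid L).iseqv.symm (Quotient.exact (Quotient.out_eq A.cls))

/-- The quasi-ordering generated by the calls of terminating atoms. -/
def callOrder (P : Program L) (a b : ExtHerbrandBase L) : Prop :=
  a = b ∨ (Terminates P [a.out] ∧ Above P a.out b.out)

theorem not_above_self {P : Program L} {A : Atom L} (h : Terminates P [A]) : ¬ Above P A A :=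
  fun hA => (not_acc_iff_exists_descending_chain (r := fun B A => Above P A B)).2
    ⟨fun _ => A, rfl, fun _ => hA⟩
    (h.acc_above (IsInstance.refl _).isPrefixInstance)

/-- Requiring termination of the larger atom makes the ordering well-founded on the whole base: a
strict descent excludes equality, so it starts at a terminating atom. -/
theorem isWellFoundedQuasiOrdering_callOrder (P : Program L) :
    IsWellFoundedQuasiOrdering (callOrder P) where
  refl a := Or.inl rfl
  trans := by
    rintro a b c (rfl | ⟨h1, h2⟩) (rfl | ⟨h3, h4⟩)
    · exact Or.inl rfl
    · exact Or.inr ⟨h3, h4⟩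
    · exact Or.inr ⟨h1, h2⟩
    · exact Or.inr ⟨h1, h2.trans h4⟩
  wf := by
    rintro ⟨s, hs⟩
    have hs' : ∀ n, Terminates P [(s n).out] ∧ Above P (s n).out (s (n + 1)).out := by
      intro n
      rcases (hs n).1 with h | h
      · exact absurd (Or.inl h.symm) (hs n).2
      · exact h
    have hacc := (hs' 0).1.acc_above (IsInstance.refl _).isPrefixInstance
    exact not_acc_iff_exists_descending_chain.2 ⟨fun n => (s n).out, rfl, fun n => (hs' n).2⟩ hacc

theorem orderAcceptable_of_ldTerminates {P : Program L} {S : Set (Atom L)}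
    (hS : ∀ A ∈ S, LDTerminates P [A]) : OrderAcceptable P S := by
  refine ⟨callOrder P, isWellFoundedQuasiOrdering_callOrder P, ?_⟩
  intro A hA c hc d hd hdis θ hθ pre B post hbody _ σ hσ
  have hterm := terminates_of_mem_call hS hA
  have habove : Above P A ((B.subst θ).subst σ) := by
    have hstep : Resolves P [A] (inst (d.body ++ []) θ) :=
      ⟨c, hc, .intro hd (by simpa using hdis) hθ⟩
    -- Solving the preceding body atoms exposes an atom more general than the instance of `B`; the
    -- atoms in `post` are harmless on the right.
    obtain ⟨M, hM, hM'⟩ := hσ.exists_reaches [B.subst θ]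
    obtain ⟨M', hM'', hM'''⟩ := hM.simulate (R := inst (d.body ++ []) θ)
      ⟨substQuery pre θ ++ [B.subst θ], inst post θ, by simp [hbody, substQuery_eq_inst],
        IsInstance.refl _⟩
    exact ⟨M', .head' hstep hM'', hM'.trans hM'''⟩
  have hout := exists_out A
  have hterm' : Terminates P [A.cls.out] :=
    hterm.of_isPrefixInstance hout.equivalent.2.isPrefixInstance
  have habove' := habove.congr hout (exists_out _)
  refine ⟨Or.inr ⟨hterm', habove'⟩, ?_⟩
  rintro (h | ⟨-, h⟩)
  · rw [h] at habove'
    exact not_above_self hterm' habove'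
  · exact not_above_self hterm' (habove'.trans h)

/-! ### Order-acceptability implies termination -/

theorem IsWellFoundedQuasiOrdering.wellFounded {α : Type*} {ge : α → α → Prop}
    (h : IsWellFoundedQuasiOrdering ge) : WellFounded fun b a => Strict ge a b := by
  rw [wellFounded_iff_isEmpty_descending_chain]
  exact ⟨fun s => h.wf ⟨s.1, s.2⟩⟩

/-- Count the head predicates on which a predicate depends. For strictly dependent `p` the count is
larger: `p` heads a clause and is counted for itself but not for `q`. -/
theorem wellFounded_depends (P : Program L) :
    WellFounded fun q p : Pred L => Depends P p q ∧ ¬ Depends P q p := by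
  classical
  let heads : Finset (Pred L) := P.image fun c => c.head.pred
  refine WellFounded.mono (measure fun p => (heads.filter fun q => Depends P p q).card).wf ?_
  rintro q p ⟨hpq, hqp⟩
  refine Finset.card_lt_card (Finset.ssubset_iff_subset_ne.2 ⟨?_, fun heq => ?_⟩)
  · intro r hr
    rw [Finset.mem_filter] at hr ⊢
    exact ⟨hr.1, hpq.trans hr.2⟩
  · rcases Relation.ReflTransGen.cases_head hpq with rfl | ⟨r, ⟨c, hc, hcp, -⟩, -⟩
    · exact hqp .refl
    · have : p ∈ heads.filter fun r => Depends P q r := by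
        rw [heq, Finset.mem_filter]
        exact ⟨Finset.mem_image.2 ⟨c, hc, hcp⟩, .refl⟩
      exact hqp (Finset.mem_filter.1 this).2

theorem terminates_of_orderAcceptable {P : Program L} {S : Set (Atom L)}
    (h : OrderAcceptable P S) {A : Atom L} (hA : A ∈ Call P S) : Terminates P [A] := by
  obtain ⟨ge, hge, hdec⟩ := h
  -- The predicate of `A` need only lie below `p`, so `p` stays fixed when the call moves to a
  -- mutually recursive predicate and only the ordering descends.
  suffices H : ∀ p : Pred L, ∀ a : ExtHerbrandBase L, ∀ A : Atom L, A.cls = a →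
      Depends P p A.pred → A ∈ Call P S → Terminates P [A] from H A.pred _ A rfl .refl hA
  intro p
  induction p using (wellFounded_depends P).induction with
  | _ p ihp =>
  intro a
  induction a using hge.wellFounded.induction with
  | _ a iha =>
  rintro A rfl hpA hA
  refine ⟨_, fun Q' hQ' => ?_⟩
  obtain ⟨c, hc, hstep⟩ := hQ'
  have hres : Resolves P [A] Q' := ⟨c, hc, hstep⟩
  cases hstep with
  | @intro _ _ d θ hd hdis hθ =>
  rw [List.append_nil] at hres ⊢
  have hdis' : Disjoint d.vars A.vars := by simpa using hdis
  -- Induction on the part of the body still to be solved: `Q'` is what remains of it once `pre` has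
  -- been solved.
  suffices H : ∀ post pre : List (Atom L), d.body = pre ++ post → ∀ Q',
      Relation.ReflTransGen (PairStep P) (inst pre θ, inst post θ) ([], Q') → Terminates P Q' from
    H d.body [] rfl _ .refl
  intro post
  induction post with
  | nil =>
    intro pre _ Q' hQ'
    obtain ⟨σ, -, hσ⟩ := exists_isComputedAnswer hQ'
    obtain ⟨f, hf⟩ := hσ.2
    rw [hf]
    exact terminates_nil P
  | cons B post ih =>
    intro pre hbody Q' hQ'
    obtain ⟨σ, hσ, heq⟩ := exists_isComputedAnswer hQ'
    obtain ⟨B', R, rfl⟩ := heq.1.eq_cons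
    have hvar : ((B.subst θ).subst σ).IsVariant B' := heq.head_isVariant
    have hreach : Reaches P [A] (B' :: R) := by
      refine .head hres ?_
      have := Relation.ReflTransGen.lift (p := Resolves P) (fun q : Query L × Query L => q.1 ++ q.2)
        (fun _ _ => PairStep.resolves) _ _ hQ'
      simpa [hbody, Function.onFun] using this
    have hB' := mem_call_of_reaches hA hreach
    have hpred : B'.pred = B.pred := by
      obtain ⟨ρ, rfl⟩ := hvar
      rfl
    have hAB : Depends P A.pred B.pred := by
      obtain ⟨ρ, hhead, hbody'⟩ := hd
      have hc1 : c.head.pred = A.pred := by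
        have h1 := congrArg Atom.pred hhead
        have h2 := congrArg Atom.pred hθ.1
        exact h1.trans h2.symm
      obtain ⟨C, hC, hCB⟩ := List.mem_map.1
        (show B ∈ c.body.map fun A => A.rename ρ by rw [hbody', hbody]; simp)
      exact .single ⟨c, hc, hc1, C, hC, show (C.rename ρ).pred = B.pred by rw [hCB]⟩
    have hterm : Terminates P [B'] := by
      -- In a mutually recursive call the ordering decreases. Otherwise `B.pred` lies strictly below
      -- `p`, since depending on `p` would make it depend on `A.pred`.
      by_cases hBA : Depends P B.pred A.pred
      · have hlt := hdec A hA c hc d hd hdis' θ hθ pre B post hbody ⟨hBA, hAB⟩ σ hσ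
        exact iha _ hlt B' (Quotient.sound hvar).symm (hpred ▸ hpA.trans hAB) hB'
      · exact ihp B.pred ⟨hpA.trans hAB, fun hBp => hBA (hBp.trans hpA)⟩ _ B' rfl
          (hpred ▸ .refl) hB'
    refine hterm.append R fun R' hR' => ?_
    refine ih (pre ++ [B]) (by simp [hbody]) R' ?_
    -- Moving the border past `B` turns the solution of `pre` into a partial solution of `pre ++
    -- [B]`, which `hR'` completes.
    have := Relation.ReflTransGen.lift (p := PairStep P)
      (fun q : Query L × Query L => (q.1 ++ q.2.take 1, q.2.drop 1))
      (fun _ _ h => PairStep.shift h 1) _ _ hQ'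
    have h1 : Relation.ReflTransGen (PairStep P) (inst (pre ++ [B]) θ, inst post θ) ([B'], R) := by
      simpa [Function.onFun] using this
    exact h1.trans hR'

end LP

theorem mainTheorem1 {L : FirstOrder.Language.{u, v}} (P : LP.Program L) (S : Set (LP.Atom L)) :
    LP.OrderAcceptable P S ↔ ∀ A ∈ S, LP.LDTerminates P [A] :=
  ⟨fun h _ hA => (LP.terminates_of_orderAcceptable h (LP.mem_call_of_mem hA)).ldTerminates,
    LP.orderAcceptable_of_ldTerminates⟩
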